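/- **Theorem.** Let $\lambda>0$, $c>0$ and $p,q\ge 0$ with $p+q=1$. A particle starts at the origin of the plane and moves at constant speed $c$; its initial direction is uniformly distributed on the four directions $d_j=(\cos\frac{\pi j}{2},\sin\frac{\pi j}{2})$, $j\in\mathbb Z/4\mathbb Z$. At the arrival times of a homogeneous Poisson process of intensity $\lambda$ the direction changes: independently of everything else, with probability $p$ from $d_j$ to $d_{j+1}$ (counter-clockwise turn) and with probability $q$ from $d_j$ to $d_{j-1}$ (clockwise turn), so that reversals $d_j\to d_{j+2}$ do not occur. Let $(X(t),Y(t))$ be the position at time $t$. For $\alpha,\beta\in\mathbb R$ put (principal square roots of complex numbers) $$A=\tfrac12\sqrt{4\lambda^2p(1-p)-c^2(\alpha^2+\beta^2)+2\sqrt{c^4\alpha^2\beta^2-\lambda^4(2p-1)^2}},$$ $$B=\tfrac12\sqrt{4\lambda^2p(1-p)-c^2(\alpha^2+\beta^2)-2\sqrt{c^4\alpha^2\beta^2-\lambda^4(2p-1)^2}},$$ $$k_0=\frac{2\lambda^2-c^2(\alpha^2+\beta^2)-2(A-B)^2}{8AB},\qquad k_1=\frac{\lambda^3-\lambda c^2(\alpha^2+\beta^2)-\lambda(A-B)^2}{4AB(A+B)},$$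 $$k_2=\frac{2\lambda^2-c^2(\alpha^2+\beta^2)-2(A+B)^2}{8AB},\qquad k_3=\frac{\lambda^3-\lambda c^2(\alpha^2+\beta^2)-\lambda(A+B)^2}{4AB(A-B)}.$$ Then for every $t\ge0$ and all $(\alpha,\beta)$ with $A\ne0$, $B\ne0$ and $A\neq\pm B$, $$\mathbb E\big[e^{i(\alpha X(t)+\beta Y(t))}\big]=e^{-\lambda t}\Big\{k_0\cosh\big((A+B)t\big)+k_1\sinh\big((A+B)t\big)-k_2\cosh\big((A-B)t\big)-k_3\sinh\big((A-B)t\big)\Big\}.$$ The set of these pairs $(\alpha,\beta)$ is dense in $\mathbb R^2$, and for every $t\ge 0$ and every $(\alpha_0,\beta_0)\in\mathbb R^2$ the right-hand side converges to $\mathbb E[e^{i(\alpha_0X(t)+\beta_0Y(t))}]$ as $(\alpha,\beta)\to(\alpha_0,\beta_0)$ along such pairs; so at the exceptional pairs the formula holds with its right-hand side read as this limit. -/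

import Mathlib

open MeasureTheory ProbabilityTheory Filter Topology

noncomputable section

/-- The random ingredients of the planar motion with orthogonal directions: the initial direction
`J₀` (the index of `d_j`, modulo `4`), the successive turns `turn 0, turn 1, …` and the successive
waiting times `τ 0, τ 1, …` between changes of direction.

* the waiting times are i.i.d. exponential of rate `lam` (so that the changes of direction occur at
  the arrival times of a homogeneous Poisson process of intensity `lam`);
* the initial direction is uniform on the four directions;
* the turns are i.i.d.: `+1` (counter-clockwise) with probability `p`, `-1` (clockwise) with
  probability `q`, `2` (reflection) with probability `1 - p - q`;
* waiting times, turns and initial direction are independent. -/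
structure IsPlanarMotionData {Ω : Type*} [MeasurableSpace Ω] (μ : Measure Ω) (p q lam : ℝ)
    (J₀ : Ω → ZMod 4) (turn : ℕ → Ω → ZMod 4) (τ : ℕ → Ω → ℝ) : Prop where
  measurable_init : Measurable J₀
  measurable_turn : ∀ n, Measurable (turn n)
  measurable_wait : ∀ n, Measurable (τ n)
  init_law : ∀ j : ZMod 4, μ.real {ω | J₀ ω = j} = 1 / 4
  turn_ccw : ∀ n, μ.real {ω | turn n ω = 1} = p
  turn_cw : ∀ n, μ.real {ω | turn n ω = -1} = q
  turn_refl : ∀ n, μ.real {ω | turn n ω = 2} = 1 - p - q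
  wait_law : ∀ n, μ.map (τ n) = expMeasure lam
  indep_turn : iIndepFun turn μ
  indep_wait : iIndepFun τ μ
  indep_init_turn : IndepFun J₀ (fun ω n => turn n ω) μ
  indep_wait_dir : IndepFun (fun ω n => τ n ω) (fun ω => (J₀ ω, fun n => turn n ω)) μ

section Motion

variable {Ω : Type*}

/-- The time of the `(n + 1)`-st change of direction. -/
def arrivalTime (τ : ℕ → Ω → ℝ) (n : ℕ) (ω : Ω) : ℝ :=
  ∑ k ∈ Finset.range (n + 1), τ k ω

/-- `N(t)`: the number of changes of direction up to time `t`. -/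
def numChanges (τ : ℕ → Ω → ℝ) (t : ℝ) (ω : Ω) : ℕ :=
  {n : ℕ | arrivalTime τ n ω ≤ t}.ncard

/-- The index modulo `4` of the direction `D(t)` at time `t`. -/
def dirIndex (J₀ : Ω → ZMod 4) (turn : ℕ → Ω → ZMod 4) (τ : ℕ → Ω → ℝ) (t : ℝ) (ω : Ω) : ZMod 4 :=
  J₀ ω + ∑ k ∈ Finset.range (numChanges τ t ω), turn k ω

/-- The direction `d_j = (cos (π j / 2), sin (π j / 2))`, `j = 0, 1, 2, 3`. -/
def direction (j : ZMod 4) : ℝ × ℝ :=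
  (Real.cos (Real.pi / 2 * (j.val : ℝ)), Real.sin (Real.pi / 2 * (j.val : ℝ)))

/-- The abscissa `X(t)` of the particle that starts at the origin and moves at speed `c` along
the current direction. -/
def posX (c : ℝ) (J₀ : Ω → ZMod 4) (turn : ℕ → Ω → ZMod 4) (τ : ℕ → Ω → ℝ) (t : ℝ) (ω : Ω) : ℝ :=
  ∫ s in (0 : ℝ)..t, c * (direction (dirIndex J₀ turn τ s ω)).1

/-- The ordinate `Y(t)` of the particle. -/
def posY (c : ℝ) (J₀ : Ω → ZMod 4) (turn : ℕ → Ω → ZMod 4) (τ : ℕ → Ω → ℝ) (t : ℝ) (ω : Ω) : ℝ :=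
  ∫ s in (0 : ℝ)..t, c * (direction (dirIndex J₀ turn τ s ω)).2

/-- `E[exp (i (α X(t) + β Y(t)))]`. -/
def motionCharFun [MeasurableSpace Ω] (μ : Measure Ω) (c : ℝ) (J₀ : Ω → ZMod 4)
    (turn : ℕ → Ω → ZMod 4) (τ : ℕ → Ω → ℝ) (α β t : ℝ) : ℂ :=
  ∫ ω, Complex.exp (Complex.I *
    ((α * posX c J₀ turn τ t ω + β * posY c J₀ turn τ t ω : ℝ) : ℂ)) ∂μ

end Motion

/-- The principal square root of a complex number. -/
def csqrt (z : ℂ) : ℂ := z ^ (1 / 2 : ℂ)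

/-- `A(α, β)`. -/
def coeffA (p lam c α β : ℝ) : ℂ :=
  1 / 2 * csqrt (4 * lam ^ 2 * p * (1 - p) - c ^ 2 * (α ^ 2 + β ^ 2)
    + 2 * csqrt (c ^ 4 * α ^ 2 * β ^ 2 - lam ^ 4 * (2 * p - 1) ^ 2))

/-- `B(α, β)`. -/
def coeffB (p lam c α β : ℝ) : ℂ :=
  1 / 2 * csqrt (4 * lam ^ 2 * p * (1 - p) - c ^ 2 * (α ^ 2 + β ^ 2)
    - 2 * csqrt (c ^ 4 * α ^ 2 * β ^ 2 - lam ^ 4 * (2 * p - 1) ^ 2))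

/-- `k₀(α, β)`. -/
def coeffK0 (p lam c α β : ℝ) : ℂ :=
  (2 * lam ^ 2 - c ^ 2 * (α ^ 2 + β ^ 2) - 2 * (coeffA p lam c α β - coeffB p lam c α β) ^ 2)
    / (8 * coeffA p lam c α β * coeffB p lam c α β)

/-- `k₁(α, β)`. -/
def coeffK1 (p lam c α β : ℝ) : ℂ :=
  (lam ^ 3 - lam * c ^ 2 * (α ^ 2 + β ^ 2)
      - lam * (coeffA p lam c α β - coeffB p lam c α β) ^ 2)
    / (4 * coeffA p lam c α β * coeffB p lam c α β
      * (coeffA p lam c α β + coeffB p lam c α β))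

/-- `k₂(α, β)`. -/
def coeffK2 (p lam c α β : ℝ) : ℂ :=
  (2 * lam ^ 2 - c ^ 2 * (α ^ 2 + β ^ 2) - 2 * (coeffA p lam c α β + coeffB p lam c α β) ^ 2)
    / (8 * coeffA p lam c α β * coeffB p lam c α β)

/-- `k₃(α, β)`. -/
def coeffK3 (p lam c α β : ℝ) : ℂ :=
  (lam ^ 3 - lam * c ^ 2 * (α ^ 2 + β ^ 2)
      - lam * (coeffA p lam c α β + coeffB p lam c α β) ^ 2)
    / (4 * coeffA p lam c α β * coeffB p lam c α β
      * (coeffA p lam c α β - coeffB p lam c α β))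

/-- The explicit expression of the characteristic function without reflection. -/
def explicitCharFun (p lam c α β t : ℝ) : ℂ :=
  Complex.exp (-(lam * t)) *
    (coeffK0 p lam c α β * Complex.cosh (coeffA p lam c α β * t + coeffB p lam c α β * t)
      + coeffK1 p lam c α β * Complex.sinh (coeffA p lam c α β * t + coeffB p lam c α β * t)
      - coeffK2 p lam c α β * Complex.cosh (coeffA p lam c α β * t - coeffB p lam c α β * t)
      - coeffK3 p lam c α β * Complex.sinh (coeffA p lam c α β * t - coeffB p lam c α β * t))

/-- The pairs `(α, β)` at which none of the denominators of `k₀, k₁, k₂, k₃` vanishes. -/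
def regularPairs (p lam c : ℝ) : Set (ℝ × ℝ) :=
  {z | coeffA p lam c z.1 z.2 ≠ 0 ∧ coeffB p lam c z.1 z.2 ≠ 0 ∧
    coeffA p lam c z.1 z.2 + coeffB p lam c z.1 z.2 ≠ 0 ∧
    coeffA p lam c z.1 z.2 - coeffB p lam c z.1 z.2 ≠ 0}

end

/-!
Fix the time `t` and let `U` solve the linear backward equation `U' = (K - lam) U`, `U 0 = 1`, on
functions of the direction, where `K` collects the phase velocities and the turns. By Duhamel's
formula, `U r j` is the expectation obtained by conditioning on the next exponential waiting time
when the direction is `j` and the time `r` is left. Hence `exp (i φ) * U r j`, with `φ` the phase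
accumulated so far, has the same expectation at every change of direction. The changes of direction
eventually exhaust the time `t`, so dominated convergence identifies this expectation with the
characteristic function, while at time `0` it is the average of `U t` over the four directions.

On the vector `1` the `4 × 4` matrix `K` satisfies
`(K ^ 2 - (A + B) ^ 2) (K ^ 2 - (A - B) ^ 2) 1 = 0`. Splitting `1` along the two factors turns
`exp (t K) 1` into hyperbolic functions of `(A ± B) t`, and the averages of `1`, `K 1`, `K ^ 2 1`,
`K ^ 3 1` produce the coefficients `k₀, …, k₃`. The characteristic function is continuous in
`(α, β)`, and on each line `β = const ≠ 0` only finitely many pairs are exceptional, which gives the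
limit statement.
-/

noncomputable section

section Independence

variable {Ω : Type*} [MeasurableSpace Ω] {μ : Measure Ω}

theorem iIndepFun_prodMk {ι : Type*} {𝓧 𝓨 : ι → Type*} [∀ i, MeasurableSpace (𝓧 i)]
    [∀ i, MeasurableSpace (𝓨 i)] {X : ∀ i, Ω → 𝓧 i} {Y : ∀ i, Ω → 𝓨 i}
    (hX : ∀ i, Measurable (X i)) (hY : ∀ i, Measurable (Y i))
    (hindX : iIndepFun X μ) (hindY : iIndepFun Y μ)
    (hXY : IndepFun (fun ω i => X i ω) (fun ω i => Y i ω) μ) :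
    iIndepFun (fun i ω => (X i ω, Y i ω)) μ := by
  let rectangles (i : ι) : Set (Set (𝓧 i × 𝓨 i)) :=
    Set.image2 (· ×ˢ ·) {A | MeasurableSet A} {B | MeasurableSet B}
  refine iIndepSets.iIndep (fun i => ((hX i).prodMk (hY i)).comap_le)
    (fun i => Set.preimage (fun ω => (X i ω, Y i ω)) '' rectangles i)
    (fun i => isPiSystem_prod.comap _)
    (fun i => by rw [← MeasurableSpace.comap_generateFrom, generateFrom_prod]) ?_
  rw [iIndepSets_iff]
  intro S f hf
  choose! R hR hRf using hf
  choose! A hA B hB hAB using hR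
  have hf' : ∀ i ∈ S, f i = X i ⁻¹' A i ∩ Y i ⁻¹' B i := fun i hi => by
    rw [← hRf i hi, ← hAB i hi]; rfl
  have hcylX : MeasurableSet ((S : Set ι).pi A) := .pi S.countable_toSet hA
  have hcylY : MeasurableSet ((S : Set ι).pi B) := .pi S.countable_toSet hB
  have hpreX : (fun ω i => X i ω) ⁻¹' (S : Set ι).pi A = ⋂ i ∈ S, X i ⁻¹' A i := by ext; simp
  have hpreY : (fun ω i => Y i ω) ⁻¹' (S : Set ι).pi B = ⋂ i ∈ S, Y i ⁻¹' B i := by ext; simp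
  have hpair : ∀ i ∈ S, μ (f i) = μ (X i ⁻¹' A i) * μ (Y i ⁻¹' B i) := fun i hi => by
    rw [hf' i hi]
    exact (hXY.comp (measurable_pi_apply i) (measurable_pi_apply i)).measure_inter_preimage_eq_mul
      _ _ (hA i hi) (hB i hi)
  calc μ (⋂ i ∈ S, f i)
      = μ ((⋂ i ∈ S, X i ⁻¹' A i) ∩ ⋂ i ∈ S, Y i ⁻¹' B i) := by
        rw [Set.iInter₂_congr hf']
        simp only [Set.iInter_inter_distrib]
    _ = μ (⋂ i ∈ S, X i ⁻¹' A i) * μ (⋂ i ∈ S, Y i ⁻¹' B i) := by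
        rw [← hpreX, ← hpreY, hXY.measure_inter_preimage_eq_mul _ _ hcylX hcylY]
    _ = ∏ i ∈ S, μ (f i) := by
        rw [hindX.measure_inter_preimage_eq_mul S hA, hindY.measure_inter_preimage_eq_mul S hB,
          ← Finset.prod_mul_distrib, Finset.prod_congr rfl hpair]

variable [IsProbabilityMeasure μ]

theorem indepFun_prodMk_of_indepFun_prodMk {𝓧 𝓨 𝓩 : Type*} [MeasurableSpace 𝓧]
    [MeasurableSpace 𝓨] [MeasurableSpace 𝓩] {X : Ω → 𝓧} {Y : Ω → 𝓨} {Z : Ω → 𝓩}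
    (hX : Measurable X) (hY : Measurable Y) (hZ : Measurable Z) (hXY : IndepFun X Y μ)
    (hXYZ : IndepFun (fun ω => (X ω, Y ω)) Z μ) : IndepFun X (fun ω => (Y ω, Z ω)) μ := by
  have hYZ : IndepFun Y Z μ := hXYZ.comp measurable_snd measurable_id
  have := Measure.isProbabilityMeasure_map (μ := μ) hX.aemeasurable
  have := Measure.isProbabilityMeasure_map (μ := μ) hY.aemeasurable
  have := Measure.isProbabilityMeasure_map (μ := μ) hZ.aemeasurable
  rw [indepFun_iff_map_prod_eq_prod_map_map (by fun_prop) (by fun_prop)] at hXY hXYZ hYZ ⊢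
  calc μ.map (fun ω => (X ω, Y ω, Z ω))
      = (μ.map fun ω => ((X ω, Y ω), Z ω)).map MeasurableEquiv.prodAssoc := by
        rw [Measure.map_map (by fun_prop) (by fun_prop)]; rfl
    _ = (μ.map X).prod (μ.map fun ω => (Y ω, Z ω)) := by
        rw [hXYZ, hXY, hYZ, (measurePreserving_prodAssoc _ _ _).map_eq]

theorem indepFun_future {𝓨 : Type*} [MeasurableSpace 𝓨] {ξ : ℕ → Ω → 𝓨}
    (hξ : ∀ n, Measurable (ξ n)) (hind : iIndepFun ξ μ) (n : ℕ) :
    IndepFun (ξ n) (fun ω k => ξ (n + 1 + k) ω) μ := by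
  refine IndepFun.indepFun_process (hξ n) (fun k => hξ (n + 1 + k)) fun I => ?_
  have hdisj : Disjoint {n} (I.image (n + 1 + ·)) := by
    simp only [Finset.disjoint_singleton_left, Finset.mem_image, not_exists, not_and]
    omega
  have hpresent : Measurable fun x : ({n} : Finset ℕ) → 𝓨 => x ⟨n, Finset.mem_singleton_self n⟩ :=
    measurable_pi_apply _
  have hfuture : Measurable fun (x : I.image (n + 1 + ·) → 𝓨) (k : I) =>
      x ⟨n + 1 + k, Finset.mem_image_of_mem _ k.2⟩ :=
    measurable_pi_iff.2 fun k => measurable_pi_apply _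
  exact (hind.indepFun_finset {n} (I.image (n + 1 + ·)) hdisj hξ).comp hpresent hfuture

theorem integral_comp_prodMk_of_indepFun {𝓧 𝓨 E : Type*} [MeasurableSpace 𝓧]
    [MeasurableSpace 𝓨] [NormedAddCommGroup E] [NormedSpace ℝ E] {X : Ω → 𝓧} {Y : Ω → 𝓨}
    (hX : Measurable X) (hY : Measurable Y) (hXY : IndepFun X Y μ) {g : 𝓧 × 𝓨 → E}
    (hg : StronglyMeasurable g) (hint : Integrable (fun ω => g (X ω, Y ω)) μ) :
    ∫ ω, g (X ω, Y ω) ∂μ = ∫ ω, ∫ y, g (X ω, y) ∂(μ.map Y) ∂μ := by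
  have := Measure.isProbabilityMeasure_map (μ := μ) hX.aemeasurable
  have := Measure.isProbabilityMeasure_map (μ := μ) hY.aemeasurable
  have hmap := (indepFun_iff_map_prod_eq_prod_map_map hX.aemeasurable hY.aemeasurable).1 hXY
  have hint' : Integrable g ((μ.map X).prod (μ.map Y)) := by
    rw [← hmap]
    exact (integrable_map_measure hg.aestronglyMeasurable (by fun_prop)).2 hint
  calc ∫ ω, g (X ω, Y ω) ∂μ = ∫ z, g z ∂((μ.map X).prod (μ.map Y)) := by
        rw [← hmap, integral_map (by fun_prop) hg.aestronglyMeasurable]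
    _ = ∫ x, ∫ y, g (x, y) ∂(μ.map Y) ∂(μ.map X) := integral_prod _ hint'
    _ = ∫ ω, ∫ y, g (X ω, y) ∂(μ.map Y) ∂μ :=
        integral_map hX.aemeasurable hint'.1.integral_prod_right'

variable {𝓧 𝓨 : Type*} [MeasurableSpace 𝓧] [MeasurableSpace 𝓨] {f : 𝓧 × 𝓨 → 𝓧} {X : ℕ → Ω → 𝓧}
  {ξ : ℕ → Ω → 𝓨}

theorem measurable_of_recursion (hf : Measurable f) (hX₀ : Measurable (X 0))
    (hξ : ∀ n, Measurable (ξ n)) (hrec : ∀ n ω, X (n + 1) ω = f (X n ω, ξ n ω)) (n : ℕ) :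
    Measurable (X n) := by
  induction n with
  | zero => exact hX₀
  | succ n ih => exact funext (hrec n) ▸ hf.comp (ih.prodMk (hξ n))

theorem indepFun_future_of_recursion (hf : Measurable f) (hX₀ : Measurable (X 0))
    (hξ : ∀ n, Measurable (ξ n)) (hrec : ∀ n ω, X (n + 1) ω = f (X n ω, ξ n ω))
    (hind : iIndepFun ξ μ) (hX₀ξ : IndepFun (X 0) (fun ω n => ξ n ω) μ) (n : ℕ) :
    IndepFun (X n) (fun ω k => ξ (n + k) ω) μ := by
  induction n with
  | zero => simpa only [zero_add] using hX₀ξ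
  | succ n ih =>
    have hXn := measurable_of_recursion hf hX₀ hξ hrec n
    have hfut : Measurable fun ω k => ξ (n + 1 + k) ω := measurable_pi_iff.2 fun k => hξ _
    have hpair : IndepFun (fun ω => ((fun k => ξ (n + 1 + k) ω), ξ n ω)) (X n) μ := by
      have hshift : Measurable fun x : ℕ → 𝓨 => ((fun k => x (1 + k)), x 0) := by fun_prop
      simpa only [Function.comp_def, add_assoc, add_zero, id] using
        ih.symm.comp hshift measurable_id
    have hstep := indepFun_prodMk_of_indepFun_prodMk hfut (hξ n) hXn
      (indepFun_future hξ hind n).symm hpair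
    rw [funext (hrec n)]
    exact (hstep.comp measurable_id (hf.comp measurable_swap)).symm

theorem integral_eq_of_harmonic_recursion {E : Type*} [NormedAddCommGroup E]
    [NormedSpace ℝ E] (hf : Measurable f) (hX₀ : Measurable (X 0)) (hξ : ∀ n, Measurable (ξ n))
    (hrec : ∀ n ω, X (n + 1) ω = f (X n ω, ξ n ω)) (hind : iIndepFun ξ μ)
    (hX₀ξ : IndepFun (X 0) (fun ω n => ξ n ω) μ) {u : 𝓧 → E} (hu : StronglyMeasurable u)
    (hint : ∀ n, Integrable (fun ω => u (X n ω)) μ)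
    (hharm : ∀ n, ∀ᵐ ω ∂μ, ∫ y, u (f (X n ω, y)) ∂(μ.map (ξ n)) = u (X n ω)) (n : ℕ) :
    ∫ ω, u (X n ω) ∂μ = ∫ ω, u (X 0 ω) ∂μ := by
  induction n with
  | zero => rfl
  | succ n ih =>
    have hXn := measurable_of_recursion hf hX₀ hξ hrec n
    have hXξ : IndepFun (X n) (ξ n) μ :=
      (indepFun_future_of_recursion hf hX₀ hξ hrec hind hX₀ξ n).comp measurable_id
        (measurable_pi_apply 0)
    have hint' := hint (n + 1)
    simp only [hrec n] at hint' ⊢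
    rw [integral_comp_prodMk_of_indepFun (g := fun z => u (f z)) hXn (hξ n) hXξ
      (hu.comp_measurable hf) hint', integral_congr_ae (hharm n), ih]

end Independence

section ExponentialLaw

variable {lam : ℝ}

theorem expMeasure_real_Ioi {x : ℝ} (hlam : 0 < lam) (hx : 0 ≤ x) :
    (expMeasure lam).real (Set.Ioi x) = Real.exp (-(lam * x)) := by
  have := isProbabilityMeasure_expMeasure hlam
  have hcdf := cdf_expMeasure_eq hlam x
  rw [if_pos hx, cdf_eq_real] at hcdf
  rw [← Set.compl_Iic, probReal_compl_eq_one_sub measurableSet_Iic, hcdf]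
  ring

theorem ae_nonneg_expMeasure (lam : ℝ) : ∀ᵐ s ∂(expMeasure lam), 0 ≤ s := by
  have hdens : ∀ s ∈ Set.Iio (0 : ℝ), exponentialPDF lam s = 0 := fun s hs =>
    exponentialPDF_of_neg hs
  rw [ae_iff]
  simp only [not_le]
  change (volume.withDensity (exponentialPDF lam)) (Set.Iio 0) = 0
  rw [withDensity_apply _ measurableSet_Iio, setLIntegral_congr_fun measurableSet_Iio hdens]
  exact lintegral_zero

variable {E : Type*} [NormedAddCommGroup E] [NormedSpace ℝ E]

theorem integral_expMeasure (hlam : 0 < lam) (f : ℝ → E) :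
    ∫ s, f s ∂(expMeasure lam) = ∫ s in Set.Ioi 0, (lam * Real.exp (-(lam * s))) • f s := by
  have hd : expMeasure lam = volume.withDensity (exponentialPDF lam) := rfl
  have hmeas : Measurable (exponentialPDF lam) :=
    (measurable_exponentialPDFReal lam).ennreal_ofReal
  rw [hd, integral_withDensity_eq_integral_toReal_smul hmeas
      (ae_of_all _ fun _ => ENNReal.ofReal_lt_top),
    ← integral_Ici_eq_integral_Ioi, ← integral_indicator measurableSet_Ici]
  congr with s
  by_cases hs : 0 ≤ s
  · rw [Set.indicator_of_mem (Set.mem_Ici.2 hs), exponentialPDF_of_nonneg hs,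
      ENNReal.toReal_ofReal (by positivity)]
  · rw [Set.indicator_of_notMem (by simpa using hs), exponentialPDF_of_neg (not_le.1 hs),
      ENNReal.toReal_zero, zero_smul]

theorem integral_min_expMeasure [CompleteSpace E] (hlam : 0 < lam) {f : ℝ → E} (hf : Continuous f)
    {r : ℝ} (hr : 0 ≤ r) :
    ∫ s, f (min s r) ∂(expMeasure lam) =
      Real.exp (-(lam * r)) • f r + ∫ s in (0 : ℝ)..r, (lam * Real.exp (-(lam * s))) • f s := by
  have hearly : IntegrableOn (fun s => (lam * Real.exp (-(lam * s))) • f (min s r))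
      (Set.Ioc 0 r) :=
    (Continuous.integrableOn_Icc (by fun_prop)).mono_set Set.Ioc_subset_Icc_self
  have hfreeze : ∀ s ∈ Set.Ioi r, (lam * Real.exp (-(lam * s))) • f (min s r) =
      (lam * Real.exp (-lam * s)) • f r := fun s hs => by
    rw [min_eq_right (le_of_lt hs), neg_mul]
  have hlate : IntegrableOn (fun s => (lam * Real.exp (-(lam * s))) • f (min s r)) (Set.Ioi r) :=
    (integrableOn_congr_fun hfreeze measurableSet_Ioi).2
      (((integrableOn_exp_mul_Ioi (neg_lt_zero.2 hlam) r).const_mul lam).smul_const (f r))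
  rw [integral_expMeasure hlam, ← Set.Ioc_union_Ioi_eq_Ioi hr,
    setIntegral_union Set.Ioc_disjoint_Ioi_same measurableSet_Ioi hearly hlate, add_comm,
    setIntegral_congr_fun measurableSet_Ioi hfreeze, integral_smul_const, integral_const_mul,
    integral_exp_mul_Ioi (neg_lt_zero.2 hlam), intervalIntegral.integral_of_le hr]
  congr 1
  · congr 1
    field_simp
  · exact setIntegral_congr_fun measurableSet_Ioc fun s hs => by
      simp only [min_eq_left hs.2]

end ExponentialLaw

section StoppedFlight

variable {G : Type*}

/-- The value of a state `(φ, r, j)` (accumulated phase, remaining time, current direction), where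
`U r j` is the expected value of `exp (i φ')` for the phase `φ'` accumulated during a time `r` from
the direction `j` on. -/
def stateValue (U : ℝ → G → ℂ) (x : ℝ × ℝ × G) : ℂ :=
  Complex.exp (Complex.I * x.1) * U x.2.1 x.2.2

/-- The state after a flight along the current direction during the waiting time `y.1`, cut off
when the remaining time is used up, and a change of direction by `y.2`. States without remaining
time keep turning, but their phase is frozen. -/
def nextState [Add G] (v : G → ℝ) (xy : (ℝ × ℝ × G) × (ℝ × G)) : ℝ × ℝ × G :=
  let (x, y) := xy
  (x.1 + v x.2.2 * min y.1 x.2.1, x.2.1 - min y.1 x.2.1, x.2.2 + y.2)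

theorem norm_stateValue (U : ℝ → G → ℂ) (x : ℝ × ℝ × G) : ‖stateValue U x‖ = ‖U x.2.1 x.2.2‖ := by
  rw [stateValue, norm_mul, mul_comm Complex.I, Complex.norm_exp_ofReal_mul_I, one_mul]

theorem nextState_remaining_mem_Icc [Add G] (v : G → ℝ) {t : ℝ} {x : ℝ × ℝ × G} {y : ℝ × G}
    (hx : x.2.1 ∈ Set.Icc 0 t) (hy : 0 ≤ y.1) : (nextState v (x, y)).2.1 ∈ Set.Icc 0 t :=
  ⟨sub_nonneg.2 (min_le_right _ _), (sub_le_self _ (le_min hy hx.1)).trans hx.2⟩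

theorem measurable_stateValue [Countable G] [MeasurableSpace G] [MeasurableSingletonClass G]
    {U : ℝ → G → ℂ} (hU : ∀ j, Measurable fun r => U r j) : Measurable (stateValue U) := by
  have hU' : Measurable fun z : ℝ × G => U z.1 z.2 := measurable_from_prod_countable_left hU
  have hphase : Measurable fun x : ℝ × ℝ × G => Complex.exp (Complex.I * x.1) := by fun_prop
  exact hphase.mul (hU'.comp measurable_snd)

theorem measurable_nextState [Add G] [Countable G] [MeasurableSpace G] [MeasurableSingletonClass G]
    (v : G → ℝ) : Measurable (nextState v) := by
  have hv : Measurable v := measurable_of_countable v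
  have hadd : Measurable fun z : G × G => z.1 + z.2 := measurable_of_countable _
  have hdir : Measurable fun z : (ℝ × ℝ × G) × (ℝ × G) => z.1.2.2 + z.2.2 :=
    hadd.comp (by fun_prop : Measurable fun z : (ℝ × ℝ × G) × (ℝ × G) => (z.1.2.2, z.2.2))
  exact Measurable.prodMk (by fun_prop) (Measurable.prodMk (by fun_prop) hdir)

end StoppedFlight

section BackwardEquation

variable {G : Type*} [Fintype G] [Add G]

/-- The infinitesimal generator of the directions, which get the increment `k` at rate
`lam * w k`, for the weight `exp (i φ)` of the phase `φ` accumulated at rate `v j` along the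
direction `j`. The diagonal term `-lam` is left out. -/
def phaseGenerator (lam : ℝ) (w v : G → ℝ) : (G → ℂ) →ₗ[ℂ] G → ℂ :=
  LinearMap.pi fun j => (Complex.I * v j) • LinearMap.proj j +
    (lam : ℂ) • ∑ k, (w k : ℂ) • LinearMap.proj (j + k)

theorem phaseGenerator_apply (lam : ℝ) (w v : G → ℝ) (u : G → ℂ) (j : G) :
    phaseGenerator lam w v u j = Complex.I * v j * u j + lam * ∑ k, w k * u (j + k) := by
  simp [phaseGenerator, LinearMap.sum_apply]

/-- `U` solves the backward equation: `U r j` is the expected weight `exp (i φ)` of the phase `φ`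
accumulated during a time `r` from the direction `j` on. -/
structure IsBackwardSolution (lam : ℝ) (w v : G → ℝ) (U : ℝ → G → ℂ) : Prop where
  init : U 0 = 1
  hasDerivAt : ∀ r, HasDerivAt U (phaseGenerator lam w v (U r) - (lam : ℂ) • U r) r

namespace IsBackwardSolution

variable {lam : ℝ} {w v : G → ℝ} {U : ℝ → G → ℂ}

theorem continuous (hU : IsBackwardSolution lam w v U) : Continuous U :=
  continuous_iff_continuousAt.2 fun r => (hU.hasDerivAt r).continuousAt

theorem exists_norm_stateValue_le (hU : IsBackwardSolution lam w v U) (t : ℝ) :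
    ∃ C, ∀ x : ℝ × ℝ × G, x.2.1 ∈ Set.Icc 0 t → ‖stateValue U x‖ ≤ C := by
  obtain ⟨C, hC⟩ := isCompact_Icc.exists_bound_of_continuousOn hU.continuous.continuousOn
  refine ⟨C, fun x hx => ?_⟩
  rw [norm_stateValue]
  exact (norm_le_pi_norm (U x.2.1) x.2.2).trans (hC _ hx)

theorem hasDerivAt_flight (hU : IsBackwardSolution lam w v U) (r s : ℝ) (j : G) :
    HasDerivAt (fun s : ℝ => Complex.exp ((Complex.I * v j - lam) * s) * U (r - s) j)
      (-(lam * Complex.exp ((Complex.I * v j - lam) * s) * ∑ k, w k * U (r - s) (j + k))) s := by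
  have hexp : HasDerivAt (fun s : ℝ => Complex.exp ((Complex.I * v j - lam) * s))
      (Complex.exp ((Complex.I * v j - lam) * s) * (Complex.I * v j - lam)) s := by
    simpa using ((hasDerivAt_id (s : ℂ)).const_mul (Complex.I * v j - lam)).cexp.comp_ofReal
  have hUj : HasDerivAt (fun s => U (r - s) j)
      (-(phaseGenerator lam w v (U (r - s)) - (lam : ℂ) • U (r - s)) j) s :=
    (hasDerivAt_pi.1 (hU.hasDerivAt (r - s)) j).comp_const_sub r s
  refine (hexp.mul hUj).congr_deriv ?_
  simp only [Pi.sub_apply, Pi.smul_apply, phaseGenerator_apply, smul_eq_mul]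
  ring

theorem duhamel (hU : IsBackwardSolution lam w v U) (r : ℝ) (j : G) :
    U r j = Complex.exp ((Complex.I * v j - lam) * r) +
      ∫ s in (0 : ℝ)..r, lam * Complex.exp ((Complex.I * v j - lam) * s) *
        ∑ k, w k * U (r - s) (j + k) := by
  have hcont := hU.continuous
  have hftc := intervalIntegral.integral_eq_sub_of_hasDerivAt
    (fun s _ => hU.hasDerivAt_flight r s j) (Continuous.intervalIntegrable (by fun_prop) 0 r)
  rw [intervalIntegral.integral_neg, neg_eq_iff_eq_neg] at hftc
  rw [hftc]
  simp [hU.init]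

theorem eq_integral_expMeasure (hlam : 0 < lam) (hw : ∑ k, w k = 1)
    (hU : IsBackwardSolution lam w v U) {r : ℝ} (hr : 0 ≤ r) (j : G) :
    U r j = ∫ s, Complex.exp (Complex.I * v j * (min s r : ℝ)) *
      ∑ k, w k * U (r - min s r) (j + k) ∂(expMeasure lam) := by
  have hcont := hU.continuous
  have hw' : ∑ k, (w k : ℂ) = 1 := mod_cast hw
  rw [integral_min_expMeasure (f := fun m : ℝ => Complex.exp (Complex.I * v j * m) *
    ∑ k, w k * U (r - m) (j + k)) hlam (by fun_prop) hr, hU.duhamel r j]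
  have hexp : ∀ s : ℝ, Complex.exp ((Complex.I * v j - lam) * s) =
      Real.exp (-(lam * s)) * Complex.exp (Complex.I * v j * s) := fun s => by
    rw [Complex.ofReal_exp, ← Complex.exp_add]
    push_cast
    ring_nf
  simp only [hexp, sub_self, hU.init, Pi.one_apply, mul_one, hw', Complex.real_smul,
    Complex.ofReal_mul, mul_assoc]

variable [MeasurableSpace G] [MeasurableSingletonClass G]

theorem measurable_stateValue (hU : IsBackwardSolution lam w v U) : Measurable (stateValue U) :=
  _root_.measurable_stateValue fun j => ((continuous_apply j).comp hU.continuous).measurable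

theorem integral_stateValue_nextState (hlam : 0 < lam) {ν : Measure G}
    [IsProbabilityMeasure ν] (hU : IsBackwardSolution lam (fun k => ν.real {k}) v U)
    {x : ℝ × ℝ × G} (hx : 0 ≤ x.2.1) :
    ∫ y, stateValue U (nextState v (x, y)) ∂((expMeasure lam).prod ν) = stateValue U x := by
  have := isProbabilityMeasure_expMeasure hlam
  have hν : ∑ k, ν.real {k} = 1 := by
    rw [sum_measureReal_singleton]
    simp
  obtain ⟨C, hC⟩ := hU.exists_norm_stateValue_le x.2.1
  have hint : Integrable (fun y => stateValue U (nextState v (x, y)))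
      ((expMeasure lam).prod ν) := by
    refine .of_bound (hU.measurable_stateValue.comp
      ((measurable_nextState v).comp measurable_prodMk_left)).aestronglyMeasurable C ?_
    filter_upwards [Measure.quasiMeasurePreserving_fst.ae (ae_nonneg_expMeasure lam)] with y hy
    exact hC _ (nextState_remaining_mem_Icc v ⟨hx, le_rfl⟩ hy)
  have hturn : ∀ s, ∫ k, stateValue U (nextState v (x, s, k)) ∂ν =
      Complex.exp (Complex.I * x.1) * (Complex.exp (Complex.I * v x.2.2 * (min s x.2.1 : ℝ)) *
        ∑ k, ν.real {k} * U (x.2.1 - min s x.2.1) (x.2.2 + k)) := fun s => by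
    rw [integral_fintype .of_finite, Finset.mul_sum, Finset.mul_sum]
    refine Finset.sum_congr rfl fun k _ => ?_
    simp only [stateValue, nextState, Complex.real_smul]
    push_cast
    rw [mul_add, Complex.exp_add]
    ring_nf
  rw [integral_prod _ hint]
  simp only [hturn]
  rw [integral_const_mul, ← hU.eq_integral_expMeasure hlam hν hx, stateValue]

end IsBackwardSolution

end BackwardEquation

section SamplePath

theorem tendsto_sum_range_atTop_of_frequently_lt {s : ℕ → ℝ} {ε : ℝ} (hε : 0 < ε)
    (hs : ∀ n, 0 ≤ s n) (hfreq : ∃ᶠ n in atTop, ε < s n) :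
    Tendsto (fun n => ∑ k ∈ Finset.range n, s k) atTop atTop := by
  rw [← not_summable_iff_tendsto_nat_atTop_of_nonneg hs]
  intro hsum
  obtain ⟨n, hlt, hgt⟩ :=
    (hfreq.and_eventually (hsum.tendsto_atTop_zero.eventually_lt_const hε)).exists
  exact lt_asymm hlt hgt

variable {Ω : Type*}

/-- The time of the `n`-th change of direction, with the convention that the motion starts at the
`0`-th change; thus `renewalTime τ (n + 1) = arrivalTime τ n`. -/
def renewalTime (τ : ℕ → Ω → ℝ) (n : ℕ) (ω : Ω) : ℝ :=
  ∑ k ∈ Finset.range n, τ k ω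

/-- The states after `0, 1, 2, …` steps of `nextState` with initial state `x₀` and with waiting
times and turns `y 0, y 1, …`. -/
def phaseState {G : Type*} [Add G] (v : G → ℝ) (x₀ : ℝ × ℝ × G) (y : ℕ → ℝ × G) : ℕ → ℝ × ℝ × G
  | 0 => x₀
  | n + 1 => nextState v (phaseState v x₀ y n, y n)

theorem phaseState_remaining_mem_Icc {G : Type*} [Add G] (v : G → ℝ) {t : ℝ} {x₀ : ℝ × ℝ × G}
    {y : ℕ → ℝ × G} (hx₀ : x₀.2.1 ∈ Set.Icc 0 t) (hy : ∀ n, 0 ≤ (y n).1) (n : ℕ) :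
    (phaseState v x₀ y n).2.1 ∈ Set.Icc 0 t := by
  induction n with
  | zero => exact hx₀
  | succ n ih => exact nextState_remaining_mem_Icc v ih (hy n)

variable {J₀ : Ω → ZMod 4} {turn : ℕ → Ω → ZMod 4} {τ : ℕ → Ω → ℝ} {ω : Ω}

theorem renewalTime_succ (τ : ℕ → Ω → ℝ) (n : ℕ) (ω : Ω) :
    renewalTime τ (n + 1) ω = renewalTime τ n ω + τ n ω :=
  Finset.sum_range_succ _ _

theorem monotone_renewalTime (hτ : ∀ n, 0 ≤ τ n ω) : Monotone fun n => renewalTime τ n ω :=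
  monotone_nat_of_le_succ fun n => by
    rw [renewalTime_succ]
    exact le_add_of_nonneg_right (hτ n)

theorem numChanges_eq (hτ : ∀ n, 0 ≤ τ n ω) {n : ℕ} {t : ℝ}
    (ht : t ∈ Set.Ico (renewalTime τ n ω) (renewalTime τ (n + 1) ω)) : numChanges τ t ω = n := by
  have hset : {k | arrivalTime τ k ω ≤ t} = ↑(Finset.range n) := by
    ext k
    rw [Set.mem_ofPred_eq, Finset.mem_coe, Finset.mem_range]
    refine ⟨fun hk => ?_, fun hk => (monotone_renewalTime hτ (Nat.succ_le_of_lt hk)).trans ht.1⟩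
    by_contra! hnk
    exact ((ht.2.trans_le (monotone_renewalTime hτ (Nat.succ_le_succ hnk))).trans_le hk).false
  rw [numChanges, hset, Set.ncard_coe_finset, Finset.card_range]

variable {E : Type*}

theorem comp_dirIndex_eqOn_uIoo (hτ : ∀ n, 0 ≤ τ n ω) (g : ZMod 4 → E) (t : ℝ) (n : ℕ) :
    (Set.uIoo (min (renewalTime τ n ω) t) (min (renewalTime τ (n + 1) ω) t)).EqOn
      (fun s => g (dirIndex J₀ turn τ s ω))
      fun _ => g (J₀ ω + ∑ k ∈ Finset.range n, turn k ω) := by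
  intro s hs
  rw [Set.uIoo_of_le (min_le_min_right t (monotone_renewalTime hτ n.le_succ)), Set.mem_Ioo,
    lt_min_iff, min_lt_iff] at hs
  have hT : renewalTime τ n ω < s := hs.1.resolve_right hs.2.2.not_gt
  simp only [dirIndex, numChanges_eq hτ ⟨hT.le, hs.2.1⟩]

variable [NormedAddCommGroup E]

theorem intervalIntegrable_comp_dirIndex_succ (hτ : ∀ n, 0 ≤ τ n ω) (g : ZMod 4 → E) (t : ℝ)
    (n : ℕ) : IntervalIntegrable (fun s => g (dirIndex J₀ turn τ s ω)) volume
      (min (renewalTime τ n ω) t) (min (renewalTime τ (n + 1) ω) t) :=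
  (intervalIntegrable_congr_uIoo (comp_dirIndex_eqOn_uIoo hτ g t n)).2 intervalIntegrable_const

theorem intervalIntegrable_comp_dirIndex (hτ : ∀ n, 0 ≤ τ n ω) (g : ZMod 4 → E) {t : ℝ}
    (ht : 0 ≤ t) (n : ℕ) : IntervalIntegrable (fun s => g (dirIndex J₀ turn τ s ω)) volume
      0 (min (renewalTime τ n ω) t) := by
  simpa [renewalTime, ht] using IntervalIntegrable.trans_iterate (n := n)
    fun k _ => intervalIntegrable_comp_dirIndex_succ (J₀ := J₀) (turn := turn) hτ g t k

theorem integral_comp_dirIndex_succ [NormedSpace ℝ E] [CompleteSpace E] (hτ : ∀ n, 0 ≤ τ n ω)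
    (g : ZMod 4 → E) {t : ℝ} (ht : 0 ≤ t) (n : ℕ) :
    ∫ s in (0 : ℝ)..min (renewalTime τ (n + 1) ω) t, g (dirIndex J₀ turn τ s ω) =
      (∫ s in (0 : ℝ)..min (renewalTime τ n ω) t, g (dirIndex J₀ turn τ s ω)) +
        (min (renewalTime τ (n + 1) ω) t - min (renewalTime τ n ω) t) •
          g (J₀ ω + ∑ k ∈ Finset.range n, turn k ω) := by
  rw [← intervalIntegral.integral_const, ← intervalIntegral.integral_congr_uIoo
      (comp_dirIndex_eqOn_uIoo hτ g t n),
    intervalIntegral.integral_add_adjacent_intervals (intervalIntegrable_comp_dirIndex hτ g ht n)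
      (intervalIntegrable_comp_dirIndex_succ hτ g t n)]

theorem phaseState_eq (hτ : ∀ n, 0 ≤ τ n ω) (v : ZMod 4 → ℝ) {t : ℝ} (ht : 0 ≤ t) (n : ℕ) :
    phaseState v (0, t, J₀ ω) (fun k => (τ k ω, turn k ω)) n =
      (∫ s in (0 : ℝ)..min (renewalTime τ n ω) t, v (dirIndex J₀ turn τ s ω),
        t - min (renewalTime τ n ω) t, J₀ ω + ∑ k ∈ Finset.range n, turn k ω) := by
  induction n with
  | zero => simp [phaseState, renewalTime, ht]
  | succ n ih =>
    have hflight : min (τ n ω) (t - min (renewalTime τ n ω) t) =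
        min (renewalTime τ (n + 1) ω) t - min (renewalTime τ n ω) t := by
      rw [renewalTime_succ]
      grind
    rw [phaseState, ih, nextState, hflight, integral_comp_dirIndex_succ hτ v ht n,
      Finset.sum_range_succ, smul_eq_mul, mul_comm (v _), ← add_assoc]
    grind

theorem eventually_phaseState_eq (hτ : ∀ n, 0 ≤ τ n ω)
    (htend : Tendsto (fun n => renewalTime τ n ω) atTop atTop) (v : ZMod 4 → ℝ) {t : ℝ}
    (ht : 0 ≤ t) : ∀ᶠ n in atTop,
      phaseState v (0, t, J₀ ω) (fun k => (τ k ω, turn k ω)) n =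
        (∫ s in (0 : ℝ)..t, v (dirIndex J₀ turn τ s ω), 0,
          J₀ ω + ∑ k ∈ Finset.range n, turn k ω) := by
  filter_upwards [htend.eventually_ge_atTop t] with n hn
  rw [phaseState_eq hτ v ht n, min_eq_right hn, sub_self]

theorem intervalIntegrable_comp_dirIndex_of_tendsto (hτ : ∀ n, 0 ≤ τ n ω)
    (htend : Tendsto (fun n => renewalTime τ n ω) atTop atTop) (g : ZMod 4 → E) {t : ℝ}
    (ht : 0 ≤ t) : IntervalIntegrable (fun s => g (dirIndex J₀ turn τ s ω)) volume 0 t := by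
  obtain ⟨n, hn⟩ := (htend.eventually_ge_atTop t).exists
  simpa only [min_eq_right hn] using
    intervalIntegrable_comp_dirIndex (J₀ := J₀) (turn := turn) hτ g ht n

end SamplePath

section PlanarMotion

theorem sum_zmod_four {M : Type*} [AddCommMonoid M] (f : ZMod 4 → M) :
    ∑ j, f j = f 0 + f 1 + f 2 + f 3 :=
  Fin.sum_univ_four f

/-- The distribution of a single turn: `1` has probability `p`, `2` has probability `1 - p - q` and
`-1 = 3` has probability `q`. -/
def turnWeight (p q : ℝ) : ZMod 4 → ℝ := ![0, p, 1 - p - q, q]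

/-- The velocity of `α X + β Y` along the direction `d_j`. -/
def projVelocity (c α β : ℝ) (j : ZMod 4) : ℝ :=
  α * (c * (direction j).1) + β * (c * (direction j).2)

variable {Ω : Type*}

theorem mul_posX_add_mul_posY {J₀ : Ω → ZMod 4} {turn : ℕ → Ω → ZMod 4} {τ : ℕ → Ω → ℝ} {ω : Ω}
    (hτ : ∀ n, 0 ≤ τ n ω) (htend : Tendsto (fun n => renewalTime τ n ω) atTop atTop)
    (c α β : ℝ) {t : ℝ} (ht : 0 ≤ t) :
    α * posX c J₀ turn τ t ω + β * posY c J₀ turn τ t ω =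
      ∫ s in (0 : ℝ)..t, projVelocity c α β (dirIndex J₀ turn τ s ω) := by
  have hint (g : ZMod 4 → ℝ) := intervalIntegrable_comp_dirIndex_of_tendsto (J₀ := J₀)
    (turn := turn) hτ htend g ht
  simp only [posX, posY, projVelocity]
  rw [intervalIntegral.integral_add (hint fun j => α * (c * (direction j).1))
      (hint fun j => β * (c * (direction j).2))]
  simp only [intervalIntegral.integral_const_mul]

namespace IsPlanarMotionData

variable [MeasurableSpace Ω] {μ : Measure Ω} {p q lam : ℝ} {J₀ : Ω → ZMod 4}
  {turn : ℕ → Ω → ZMod 4} {τ : ℕ → Ω → ℝ}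

theorem measurable_step (h : IsPlanarMotionData μ p q lam J₀ turn τ) (n : ℕ) :
    Measurable fun ω => (τ n ω, turn n ω) :=
  (h.measurable_wait n).prodMk (h.measurable_turn n)

theorem ae_wait_nonneg (h : IsPlanarMotionData μ p q lam J₀ turn τ) : ∀ᵐ ω ∂μ, ∀ n, 0 ≤ τ n ω :=
  ae_all_iff.2 fun n => ae_of_ae_map (h.measurable_wait n).aemeasurable <| by
    rw [h.wait_law n]
    exact ae_nonneg_expMeasure lam

theorem iIndepFun_step (h : IsPlanarMotionData μ p q lam J₀ turn τ) :
    iIndepFun (fun n ω => (τ n ω, turn n ω)) μ :=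
  iIndepFun_prodMk h.measurable_wait h.measurable_turn h.indep_wait h.indep_turn
    (h.indep_wait_dir.comp measurable_id measurable_snd)

theorem measurable_phaseState (h : IsPlanarMotionData μ p q lam J₀ turn τ) (v : ZMod 4 → ℝ)
    (t : ℝ) (n : ℕ) :
    Measurable fun ω => phaseState v (0, t, J₀ ω) (fun k => (τ k ω, turn k ω)) n := by
  have hinit := h.measurable_init
  exact measurable_of_recursion
    (X := fun n ω => phaseState v (0, t, J₀ ω) (fun k => (τ k ω, turn k ω)) n)
    (measurable_nextState v) (by simp only [phaseState]; fun_prop) h.measurable_step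
    (fun _ _ => rfl) n

theorem exists_ae_norm_stateValue_phaseState_le (h : IsPlanarMotionData μ p q lam J₀ turn τ)
    {w v : ZMod 4 → ℝ} {U : ℝ → ZMod 4 → ℂ} (hU : IsBackwardSolution lam w v U) {t : ℝ}
    (ht : 0 ≤ t) : ∃ C, ∀ n, ∀ᵐ ω ∂μ,
      ‖stateValue U (phaseState v (0, t, J₀ ω) (fun k => (τ k ω, turn k ω)) n)‖ ≤ C := by
  obtain ⟨C, hC⟩ := hU.exists_norm_stateValue_le t
  refine ⟨C, fun n => ?_⟩
  filter_upwards [h.ae_wait_nonneg] with ω hτ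
  exact hC _ (phaseState_remaining_mem_Icc v ⟨ht, le_rfl⟩ hτ n)

variable [IsProbabilityMeasure μ]

theorem indepFun_init_step (h : IsPlanarMotionData μ p q lam J₀ turn τ) :
    IndepFun J₀ (fun ω n => (τ n ω, turn n ω)) μ := by
  have hzip : Measurable fun z : (ℕ → ZMod 4) × (ℕ → ℝ) => fun n => (z.2 n, z.1 n) := by fun_prop
  exact (indepFun_prodMk_of_indepFun_prodMk h.measurable_init
    (measurable_pi_iff.2 h.measurable_turn) (measurable_pi_iff.2 h.measurable_wait)
    h.indep_init_turn h.indep_wait_dir.symm).comp measurable_id hzip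

theorem map_step (h : IsPlanarMotionData μ p q lam J₀ turn τ) (n : ℕ) :
    μ.map (fun ω => (τ n ω, turn n ω)) = (expMeasure lam).prod (μ.map (turn n)) := by
  have := Measure.isProbabilityMeasure_map (μ := μ) (h.measurable_turn n).aemeasurable
  have := Measure.isProbabilityMeasure_map (μ := μ) (h.measurable_wait n).aemeasurable
  have hind : IndepFun (τ n) (turn n) μ := h.indep_wait_dir.comp (measurable_pi_apply n)
    ((measurable_pi_apply n).comp measurable_snd)
  rw [(indepFun_iff_map_prod_eq_prod_map_map (h.measurable_wait n).aemeasurable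
    (h.measurable_turn n).aemeasurable).1 hind, h.wait_law n]

theorem map_turn_real_singleton (h : IsPlanarMotionData μ p q lam J₀ turn τ) (n : ℕ) (k : ZMod 4) :
    (μ.map (turn n)).real {k} = turnWeight p q k := by
  have := Measure.isProbabilityMeasure_map (μ := μ) (h.measurable_turn n).aemeasurable
  have hmap (k : ZMod 4) : (μ.map (turn n)).real {k} = μ.real {ω | turn n ω = k} :=
    map_measureReal_apply (h.measurable_turn n) (measurableSet_singleton k)
  have h1 := (hmap 1).trans (h.turn_ccw n)
  have h2 := (hmap 2).trans (h.turn_refl n)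
  have h3 := (hmap 3).trans (h.turn_cw n)
  have htotal : (μ.map (turn n)).real {0} + (μ.map (turn n)).real {1} +
      (μ.map (turn n)).real {2} + (μ.map (turn n)).real {3} = 1 := by
    rw [← sum_zmod_four fun k => (μ.map (turn n)).real {k}, sum_measureReal_singleton,
      Finset.coe_univ, probReal_univ]
  have h0 : (μ.map (turn n)).real {0} = 0 := by linarith
  fin_cases k
  exacts [h0, h1, h2, h3]

theorem integral_comp_init (h : IsPlanarMotionData μ p q lam J₀ turn τ) (g : ZMod 4 → ℂ) :
    ∫ ω, g (J₀ ω) ∂μ = 1 / 4 * ∑ j, g j := by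
  have hlaw (j : ZMod 4) : (μ.map J₀).real {j} = 1 / 4 :=
    (map_measureReal_apply h.measurable_init (measurableSet_singleton j)).trans (h.init_law j)
  have := Measure.isProbabilityMeasure_map (μ := μ) h.measurable_init.aemeasurable
  rw [← integral_map h.measurable_init.aemeasurable
    (measurable_of_countable g).aestronglyMeasurable, integral_fintype .of_finite, Finset.mul_sum]
  simp [hlaw]

theorem ae_tendsto_renewalTime (h : IsPlanarMotionData μ p q lam J₀ turn τ) (hlam : 0 < lam) :
    ∀ᵐ ω ∂μ, Tendsto (fun n => renewalTime τ n ω) atTop atTop := by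
  have := isProbabilityMeasure_expMeasure hlam
  have hmeas : ∀ n, MeasurableSet (τ n ⁻¹' Set.Ioi 1) := fun n =>
    h.measurable_wait n measurableSet_Ioi
  have hind : iIndepSet (fun n => τ n ⁻¹' Set.Ioi 1) μ :=
    (iIndepSet_iff_meas_biInter hmeas).2 fun S =>
      h.indep_wait.measure_inter_preimage_eq_mul S fun _ _ => measurableSet_Ioi
  have hprob : ∀ n, μ (τ n ⁻¹' Set.Ioi 1) = ENNReal.ofReal (Real.exp (-(lam * 1))) := fun n => by
    rw [← Measure.map_apply (h.measurable_wait n) measurableSet_Ioi, h.wait_law n,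
      ← expMeasure_real_Ioi hlam zero_le_one, ofReal_measureReal]
  have hlimsup : μ (limsup (fun n => τ n ⁻¹' Set.Ioi 1) atTop) = 1 := by
    refine measure_limsup_eq_one hmeas hind ?_
    simp only [hprob]
    exact ENNReal.tsum_const_eq_top_of_ne_zero (by simp [Real.exp_pos])
  filter_upwards [(mem_ae_iff_prob_eq_one (MeasurableSet.measurableSet_limsup hmeas)).2 hlimsup,
    h.ae_wait_nonneg] with ω hfreq hτ
  exact tendsto_sum_range_atTop_of_frequently_lt one_pos hτ (mem_limsup_iff_frequently_mem.1 hfreq)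

theorem integral_stateValue_phaseState (h : IsPlanarMotionData μ p q lam J₀ turn τ)
    (hlam : 0 < lam) {v : ZMod 4 → ℝ} {U : ℝ → ZMod 4 → ℂ}
    (hU : IsBackwardSolution lam (turnWeight p q) v U) {t : ℝ} (ht : 0 ≤ t) (n : ℕ) :
    ∫ ω, stateValue U (phaseState v (0, t, J₀ ω) (fun k => (τ k ω, turn k ω)) n) ∂μ =
      1 / 4 * ∑ j, U t j := by
  let X (n : ℕ) (ω : Ω) := phaseState v (0, t, J₀ ω) (fun k => (τ k ω, turn k ω)) n
  have hX (n : ℕ) : Measurable (X n) := h.measurable_phaseState v t n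
  have hembed : Measurable fun j : ZMod 4 => ((0 : ℝ), t, j) := by fun_prop
  have hind : IndepFun (X 0) (fun ω n => (τ n ω, turn n ω)) μ :=
    h.indepFun_init_step.comp hembed measurable_id
  obtain ⟨C, hC⟩ := h.exists_ae_norm_stateValue_phaseState_le hU ht
  have hint (n : ℕ) : Integrable (fun ω => stateValue U (X n ω)) μ :=
    .of_bound (hU.measurable_stateValue.comp (hX n)).aestronglyMeasurable C (hC n)
  have hharm (n : ℕ) : ∀ᵐ ω ∂μ, ∫ y, stateValue U (nextState v (X n ω, y))
      ∂(μ.map fun ω => (τ n ω, turn n ω)) = stateValue U (X n ω) := by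
    have := Measure.isProbabilityMeasure_map (μ := μ) (h.measurable_turn n).aemeasurable
    rw [h.map_step n]
    filter_upwards [h.ae_wait_nonneg] with ω hτ
    rw [← funext (h.map_turn_real_singleton n)] at hU
    exact hU.integral_stateValue_nextState hlam
      (phaseState_remaining_mem_Icc v ⟨ht, le_rfl⟩ hτ n).1
  calc ∫ ω, stateValue U (X n ω) ∂μ = ∫ ω, stateValue U (X 0 ω) ∂μ :=
        integral_eq_of_harmonic_recursion (measurable_nextState v) (hX 0) h.measurable_step
          (fun _ _ => rfl) h.iIndepFun_step hind hU.measurable_stateValue.stronglyMeasurable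
          hint hharm n
    _ = ∫ ω, U t (J₀ ω) ∂μ := by simp [X, phaseState, stateValue]
    _ = 1 / 4 * ∑ j, U t j := h.integral_comp_init (U t)

theorem ae_eventually_phaseState_eq (h : IsPlanarMotionData μ p q lam J₀ turn τ) (hlam : 0 < lam)
    (c α β : ℝ) {t : ℝ} (ht : 0 ≤ t) : ∀ᵐ ω ∂μ, ∀ᶠ n in atTop,
      phaseState (projVelocity c α β) (0, t, J₀ ω) (fun k => (τ k ω, turn k ω)) n =
        (α * posX c J₀ turn τ t ω + β * posY c J₀ turn τ t ω, 0,
          J₀ ω + ∑ k ∈ Finset.range n, turn k ω) := by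
  filter_upwards [h.ae_wait_nonneg, h.ae_tendsto_renewalTime hlam] with ω hτ htend
  rw [mul_posX_add_mul_posY hτ htend c α β ht]
  exact eventually_phaseState_eq hτ htend (projVelocity c α β) ht

theorem motionCharFun_eq (h : IsPlanarMotionData μ p q lam J₀ turn τ) (hlam : 0 < lam)
    {c α β : ℝ} {U : ℝ → ZMod 4 → ℂ}
    (hU : IsBackwardSolution lam (turnWeight p q) (projVelocity c α β) U) {t : ℝ} (ht : 0 ≤ t) :
    motionCharFun μ c J₀ turn τ α β t = 1 / 4 * ∑ j, U t j := by
  obtain ⟨C, hC⟩ := h.exists_ae_norm_stateValue_phaseState_le hU ht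
  have hlim : Tendsto (fun n => ∫ ω, stateValue U (phaseState (projVelocity c α β) (0, t, J₀ ω)
      (fun k => (τ k ω, turn k ω)) n) ∂μ) atTop (𝓝 (motionCharFun μ c J₀ turn τ α β t)) := by
    refine tendsto_integral_of_dominated_convergence (fun _ => C) (fun n =>
      (hU.measurable_stateValue.comp (h.measurable_phaseState _ t n)).aestronglyMeasurable)
      (integrable_const C) hC ?_
    filter_upwards [h.ae_eventually_phaseState_eq hlam c α β ht] with ω hω
    refine tendsto_const_nhds.congr' ?_
    filter_upwards [hω] with n hn
    simp [hn, stateValue, hU.init]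
  exact tendsto_nhds_unique hlim
    (tendsto_const_nhds.congr fun n => (h.integral_stateValue_phaseState hlam hU ht n).symm)

theorem aemeasurable_mul_posX_add_mul_posY (h : IsPlanarMotionData μ p q lam J₀ turn τ)
    (hlam : 0 < lam) (c α β : ℝ) {t : ℝ} (ht : 0 ≤ t) :
    AEMeasurable (fun ω => α * posX c J₀ turn τ t ω + β * posY c J₀ turn τ t ω) μ := by
  refine aemeasurable_of_tendsto_metrizable_ae atTop
    (fun n => (h.measurable_phaseState (projVelocity c α β) t n).fst.aemeasurable) ?_
  filter_upwards [h.ae_eventually_phaseState_eq hlam c α β ht] with ω hω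
  exact tendsto_const_nhds.congr' (hω.mono fun n hn => (congrArg Prod.fst hn).symm)

theorem continuous_motionCharFun (h : IsPlanarMotionData μ p q lam J₀ turn τ) (hlam : 0 < lam)
    (c : ℝ) {t : ℝ} (ht : 0 ≤ t) :
    Continuous fun z : ℝ × ℝ => motionCharFun μ c J₀ turn τ z.1 z.2 t := by
  refine continuous_of_dominated (bound := fun _ => 1) (fun z => ?_)
    (fun z => ae_of_all _ fun ω => ?_) (integrable_const 1)
    (ae_of_all _ fun ω => by fun_prop)
  · have := h.aemeasurable_mul_posX_add_mul_posY hlam c z.1 z.2 ht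
    exact AEMeasurable.aestronglyMeasurable (by fun_prop)
  · rw [mul_comm Complex.I, Complex.norm_exp_ofReal_mul_I]

end IsPlanarMotionData

end PlanarMotion

section QuarticFlow

variable {E : Type*} [NormedAddCommGroup E] [NormedSpace ℂ E]

/-- The solution of `f' = L f`, `f 0 = u`, for `L` linear and `L (L u) = x ^ 2 • u`, `x ≠ 0`. -/
def coshSinhFlow (L : E →ₗ[ℂ] E) (x : ℂ) (u : E) (t : ℝ) : E :=
  Complex.cosh (x * t) • u + (Complex.sinh (x * t) / x) • L u

/-- The component in the kernel of `L ^ 2 - x ^ 2` of a vector `u` in the kernel of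
`(L ^ 2 - x ^ 2) (L ^ 2 - y ^ 2)`, where `x ^ 2 ≠ y ^ 2`. -/
def quadraticComponent (L : E →ₗ[ℂ] E) (x y : ℂ) (u : E) : E :=
  (x ^ 2 - y ^ 2)⁻¹ • (L (L u) - y ^ 2 • u)

/-- The solution of `f' = L f`, `f 0 = u`, for a vector `u` in the kernel of
`(L ^ 2 - x ^ 2) (L ^ 2 - y ^ 2)`, where `x ^ 2 ≠ y ^ 2` and `x, y ≠ 0`. -/
def quarticFlow (L : E →ₗ[ℂ] E) (x y : ℂ) (u : E) (t : ℝ) : E :=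
  coshSinhFlow L x (quadraticComponent L x y u) t + coshSinhFlow L y (quadraticComponent L y x u) t

variable {L : E →ₗ[ℂ] E} {x y : ℂ} {u : E}

theorem coshSinhFlow_zero (L : E →ₗ[ℂ] E) (x : ℂ) (u : E) : coshSinhFlow L x u 0 = u := by
  simp [coshSinhFlow]

theorem hasDerivAt_coshSinhFlow (hx : x ≠ 0) (hu : L (L u) = x ^ 2 • u) (t : ℝ) :
    HasDerivAt (coshSinhFlow L x u) (L (coshSinhFlow L x u t)) t := by
  have hlin : HasDerivAt (fun z : ℂ => x * z) x t := by
    simpa using (hasDerivAt_id (t : ℂ)).const_mul x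
  have hcosh := hlin.ccosh.comp_ofReal
  have hsinh := (hlin.csinh.div_const x).comp_ofReal
  refine ((hcosh.smul_const u).add (hsinh.smul_const (L u))).congr_deriv ?_
  rw [coshSinhFlow, map_add, map_smul, map_smul, hu]
  match_scalars <;> field_simp

theorem quadraticComponent_add_quadraticComponent (hxy : x ^ 2 ≠ y ^ 2) :
    quadraticComponent L x y u + quadraticComponent L y x u = u := by
  have hxy' := sub_ne_zero.2 hxy
  have hyx := sub_ne_zero.2 hxy.symm
  rw [quadraticComponent, quadraticComponent]
  match_scalars
  · field_simp
    ring
  · field_simp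
    ring

theorem map_map_quadraticComponent
    (hu : L (L (L (L u))) = (x ^ 2 + y ^ 2) • L (L u) - (x ^ 2 * y ^ 2) • u) :
    L (L (quadraticComponent L x y u)) = x ^ 2 • quadraticComponent L x y u := by
  simp only [quadraticComponent, map_smul, map_sub, hu]
  module

theorem quarticFlow_zero (hxy : x ^ 2 ≠ y ^ 2) : quarticFlow L x y u 0 = u := by
  rw [quarticFlow, coshSinhFlow_zero, coshSinhFlow_zero,
    quadraticComponent_add_quadraticComponent hxy]

theorem hasDerivAt_quarticFlow (hx : x ≠ 0) (hy : y ≠ 0)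
    (hu : L (L (L (L u))) = (x ^ 2 + y ^ 2) • L (L u) - (x ^ 2 * y ^ 2) • u) (t : ℝ) :
    HasDerivAt (quarticFlow L x y u) (L (quarticFlow L x y u t)) t := by
  have hu' : L (L (L (L u))) = (y ^ 2 + x ^ 2) • L (L u) - (y ^ 2 * x ^ 2) • u := by
    rw [hu, add_comm, mul_comm]
  rw [quarticFlow, map_add]
  exact (hasDerivAt_coshSinhFlow hx (map_map_quadraticComponent hu) t).add
    (hasDerivAt_coshSinhFlow hy (map_map_quadraticComponent hu') t)

theorem isBackwardSolution_exp_smul_quarticFlow {G : Type*} [Fintype G] [Add G] {lam : ℝ}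
    {w v : G → ℝ} (hx : x ≠ 0) (hy : y ≠ 0) (hxy : x ^ 2 ≠ y ^ 2)
    (hgen : phaseGenerator lam w v (phaseGenerator lam w v (phaseGenerator lam w v
        (phaseGenerator lam w v 1))) =
      (x ^ 2 + y ^ 2) • phaseGenerator lam w v (phaseGenerator lam w v 1) -
        (x ^ 2 * y ^ 2) • (1 : G → ℂ)) :
    IsBackwardSolution lam w v fun t =>
      Complex.exp (-(lam * t)) • quarticFlow (phaseGenerator lam w v) x y 1 t where
  init := by simp [quarticFlow_zero hxy]
  hasDerivAt t := by
    have hexp : HasDerivAt (fun t : ℝ => Complex.exp (-(lam * t)))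
        (Complex.exp (-(lam * t)) * -lam) t := by
      simpa using ((hasDerivAt_id (t : ℂ)).const_mul (lam : ℂ)).neg.cexp.comp_ofReal
    refine (hexp.smul (hasDerivAt_quarticFlow hx hy hgen t)).congr_deriv ?_
    rw [map_smul]
    module

end QuarticFlow

section ExplicitFormula

theorem csqrt_sq (z : ℂ) : csqrt z ^ 2 = z := by
  rw [csqrt, one_div]
  exact Complex.cpow_nat_inv_pow z two_ne_zero

variable (p lam c α β : ℝ)

theorem coeffA_sq : coeffA p lam c α β ^ 2 = 1 / 4 *
    (4 * lam ^ 2 * p * (1 - p) - c ^ 2 * (α ^ 2 + β ^ 2) +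
      2 * csqrt (c ^ 4 * α ^ 2 * β ^ 2 - lam ^ 4 * (2 * p - 1) ^ 2)) := by
  rw [coeffA, mul_pow, csqrt_sq]
  ring

theorem coeffB_sq : coeffB p lam c α β ^ 2 = 1 / 4 *
    (4 * lam ^ 2 * p * (1 - p) - c ^ 2 * (α ^ 2 + β ^ 2) -
      2 * csqrt (c ^ 4 * α ^ 2 * β ^ 2 - lam ^ 4 * (2 * p - 1) ^ 2)) := by
  rw [coeffB, mul_pow, csqrt_sq]
  ring

theorem sq_coeffA_add_coeffB_add_sq_coeffA_sub_coeffB :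
    (coeffA p lam c α β + coeffB p lam c α β) ^ 2 + (coeffA p lam c α β - coeffB p lam c α β) ^ 2 =
      4 * lam ^ 2 * p * (1 - p) - c ^ 2 * (α ^ 2 + β ^ 2) := by
  linear_combination 2 * coeffA_sq p lam c α β + 2 * coeffB_sq p lam c α β

theorem sq_coeffA_add_coeffB_mul_sq_coeffA_sub_coeffB :
    (coeffA p lam c α β + coeffB p lam c α β) ^ 2 * (coeffA p lam c α β - coeffB p lam c α β) ^ 2 =
      c ^ 4 * α ^ 2 * β ^ 2 - lam ^ 4 * (2 * p - 1) ^ 2 := by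
  have hdiff : coeffA p lam c α β ^ 2 - coeffB p lam c α β ^ 2 =
      csqrt (c ^ 4 * α ^ 2 * β ^ 2 - lam ^ 4 * (2 * p - 1) ^ 2) := by
    linear_combination coeffA_sq p lam c α β - coeffB_sq p lam c α β
  rw [← csqrt_sq (c ^ 4 * α ^ 2 * β ^ 2 - lam ^ 4 * (2 * p - 1) ^ 2), ← hdiff]
  ring

theorem projVelocity_zero : projVelocity c α β 0 = c * α := by
  simp [projVelocity, direction, mul_comm]

theorem projVelocity_one : projVelocity c α β 1 = c * β := by
  have hval : (1 : ZMod 4).val = 1 := rfl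
  simp [projVelocity, direction, hval, mul_comm]

theorem projVelocity_two : projVelocity c α β 2 = -(c * α) := by
  have hval : (2 : ZMod 4).val = 2 := rfl
  have hangle : Real.pi / 2 * (2 : ℕ) = Real.pi := by
    push_cast
    ring
  rw [projVelocity, direction, hval, hangle, Real.cos_pi, Real.sin_pi]
  ring

theorem projVelocity_three : projVelocity c α β 3 = -(c * β) := by
  have hval : (3 : ZMod 4).val = 3 := rfl
  have hangle : Real.pi / 2 * (3 : ℕ) = Real.pi / 2 + Real.pi := by
    push_cast
    ring
  rw [projVelocity, direction, hval, hangle, Real.cos_add_pi, Real.sin_add_pi, Real.cos_pi_div_two,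
    Real.sin_pi_div_two]
  ring

/-- The generator of the directions, weighted by the phase `α X + β Y`, of the motion without
reversals. -/
def motionGenerator : (ZMod 4 → ℂ) →ₗ[ℂ] ZMod 4 → ℂ :=
  phaseGenerator lam (turnWeight p (1 - p)) (projVelocity c α β)

theorem motionGenerator_apply (u : ZMod 4 → ℂ) (j : ZMod 4) :
    motionGenerator p lam c α β u j =
      Complex.I * projVelocity c α β j * u j + lam * (p * u (j + 1) + (1 - p) * u (j + 3)) := by
  have hweight : turnWeight p (1 - p) 0 = 0 ∧ turnWeight p (1 - p) 1 = p ∧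
      turnWeight p (1 - p) 2 = 1 - p - (1 - p) ∧ turnWeight p (1 - p) 3 = 1 - p :=
    ⟨rfl, rfl, rfl, rfl⟩
  obtain ⟨h0, h1, h2, h3⟩ := hweight
  simp [motionGenerator, phaseGenerator_apply, sum_zmod_four, h0, h1, h2, h3]

variable {p lam c α β} (u : ZMod 4 → ℂ)

theorem motionGenerator_apply_zero : motionGenerator p lam c α β u 0 =
    Complex.I * (c * α) * u 0 + lam * (p * u 1 + (1 - p) * u 3) := by
  rw [motionGenerator_apply, projVelocity_zero, zero_add, zero_add]
  push_cast
  rfl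

theorem motionGenerator_apply_one : motionGenerator p lam c α β u 1 =
    Complex.I * (c * β) * u 1 + lam * (p * u 2 + (1 - p) * u 0) := by
  rw [motionGenerator_apply, projVelocity_one]
  push_cast
  rfl

theorem motionGenerator_apply_two : motionGenerator p lam c α β u 2 =
    -(Complex.I * (c * α) * u 2) + lam * (p * u 3 + (1 - p) * u 1) := by
  rw [motionGenerator_apply, projVelocity_two]
  push_cast
  rw [mul_neg, neg_mul]
  rfl

theorem motionGenerator_apply_three : motionGenerator p lam c α β u 3 =
    -(Complex.I * (c * β) * u 3) + lam * (p * u 0 + (1 - p) * u 2) := by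
  rw [motionGenerator_apply, projVelocity_three]
  push_cast
  rw [mul_neg, neg_mul]
  rfl

variable (p lam c α β)

theorem motionGenerator_quartic_one :
    motionGenerator p lam c α β (motionGenerator p lam c α β (motionGenerator p lam c α β
        (motionGenerator p lam c α β 1))) =
      (4 * lam ^ 2 * p * (1 - p) - c ^ 2 * (α ^ 2 + β ^ 2) : ℂ) •
          motionGenerator p lam c α β (motionGenerator p lam c α β 1) -
        (c ^ 4 * α ^ 2 * β ^ 2 - lam ^ 4 * (2 * p - 1) ^ 2 : ℂ) • 1 := by
  have hI4 : Complex.I ^ 4 = 1 := Complex.I_pow_four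
  have hI3 : Complex.I ^ 3 = -Complex.I := Complex.I_pow_three
  funext j
  obtain rfl | rfl | rfl | rfl : j = 0 ∨ j = 1 ∨ j = 2 ∨ j = 3 := by revert j; decide
  all_goals
    simp only [Pi.sub_apply, Pi.smul_apply, Pi.one_apply, smul_eq_mul, motionGenerator_apply_zero,
      motionGenerator_apply_one, motionGenerator_apply_two, motionGenerator_apply_three]
    ring_nf
    simp only [Complex.I_sq, hI3, hI4]
    ring

/-- The expectation of `u j` for a uniformly distributed direction `j`. -/
def dirAverage : (ZMod 4 → ℂ) →ₗ[ℂ] ℂ :=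
  (1 / 4 : ℂ) • ∑ j, LinearMap.proj j

theorem dirAverage_apply : dirAverage u = 1 / 4 * ∑ j, u j := by
  simp [dirAverage, LinearMap.sum_apply]

theorem dirAverage_one : dirAverage 1 = 1 := by
  simp [dirAverage_apply]

theorem dirAverage_motionGenerator_one :
    dirAverage (motionGenerator p lam c α β 1) = lam := by
  rw [dirAverage_apply, sum_zmod_four]
  simp only [Pi.one_apply, motionGenerator_apply_zero, motionGenerator_apply_one,
    motionGenerator_apply_two, motionGenerator_apply_three]
  ring

theorem dirAverage_motionGenerator_sq_one :
    dirAverage (motionGenerator p lam c α β (motionGenerator p lam c α β 1)) =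
      lam ^ 2 - c ^ 2 * (α ^ 2 + β ^ 2) / 2 := by
  rw [dirAverage_apply, sum_zmod_four]
  simp only [Pi.one_apply, motionGenerator_apply_zero, motionGenerator_apply_one,
    motionGenerator_apply_two, motionGenerator_apply_three]
  ring_nf
  simp only [Complex.I_sq]
  ring

theorem dirAverage_motionGenerator_cube_one :
    dirAverage (motionGenerator p lam c α β (motionGenerator p lam c α β
        (motionGenerator p lam c α β 1))) =
      lam ^ 3 - lam * c ^ 2 * (α ^ 2 + β ^ 2) := by
  rw [dirAverage_apply, sum_zmod_four]
  simp only [Pi.one_apply, motionGenerator_apply_zero, motionGenerator_apply_one,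
    motionGenerator_apply_two, motionGenerator_apply_three]
  ring_nf
  simp only [Complex.I_sq]
  ring

variable {p lam c α β}

theorem sq_coeffA_add_coeffB_ne_sq_coeffA_sub_coeffB (h : (α, β) ∈ regularPairs p lam c) :
    (coeffA p lam c α β + coeffB p lam c α β) ^ 2 ≠
      (coeffA p lam c α β - coeffB p lam c α β) ^ 2 := by
  obtain ⟨hA, hB, -, -⟩ := h
  have hdiff : (coeffA p lam c α β + coeffB p lam c α β) ^ 2 -
      (coeffA p lam c α β - coeffB p lam c α β) ^ 2 =
        4 * (coeffA p lam c α β * coeffB p lam c α β) := by ring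
  rw [← sub_ne_zero, hdiff]
  exact mul_ne_zero (by norm_num) (mul_ne_zero hA hB)

theorem isBackwardSolution_of_mem_regularPairs (h : (α, β) ∈ regularPairs p lam c) :
    IsBackwardSolution lam (turnWeight p (1 - p)) (projVelocity c α β) fun t =>
      Complex.exp (-(lam * t)) • quarticFlow (motionGenerator p lam c α β)
        (coeffA p lam c α β + coeffB p lam c α β) (coeffA p lam c α β - coeffB p lam c α β)
        1 t := by
  have hne := sq_coeffA_add_coeffB_ne_sq_coeffA_sub_coeffB h
  obtain ⟨-, -, hadd, hsub⟩ := h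
  refine isBackwardSolution_exp_smul_quarticFlow hadd hsub hne ?_
  rw [← motionGenerator, motionGenerator_quartic_one,
    sq_coeffA_add_coeffB_add_sq_coeffA_sub_coeffB, sq_coeffA_add_coeffB_mul_sq_coeffA_sub_coeffB]

theorem dirAverage_quarticFlow_eq_explicitCharFun (h : (α, β) ∈ regularPairs p lam c) (t : ℝ) :
    dirAverage (Complex.exp (-(lam * t)) • quarticFlow (motionGenerator p lam c α β)
        (coeffA p lam c α β + coeffB p lam c α β) (coeffA p lam c α β - coeffB p lam c α β) 1 t) =
      explicitCharFun p lam c α β t := by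
  obtain ⟨hA, hB, hadd, hsub⟩ := h
  simp only [quarticFlow, coshSinhFlow, quadraticComponent, map_add, map_sub, map_smul,
    smul_eq_mul, dirAverage_one, dirAverage_motionGenerator_one,
    dirAverage_motionGenerator_sq_one, dirAverage_motionGenerator_cube_one, explicitCharFun,
    coeffK0, coeffK1, coeffK2, coeffK3]
  generalize coeffA p lam c α β = A at *
  generalize coeffB p lam c α β = B at *
  have hden : (A + B) ^ 2 - (A - B) ^ 2 = 4 * A * B := by ring
  have hden' : (A - B) ^ 2 - (A + B) ^ 2 = -(4 * A * B) := by ring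
  rw [hden, hden', ← add_mul, ← sub_mul]
  field_simp
  ring

end ExplicitFormula

section Density

open Polynomial in
theorem finite_setOf_biquadratic_eq_zero {R : Type*} [CommRing R] [IsDomain R] {a b : R} (d : R)
    (h : a ≠ 0 ∨ b ≠ 0) : {x : R | a * x ^ 4 + b * x ^ 2 + d = 0}.Finite := by
  have hne : C a * X ^ 4 + C b * X ^ 2 + C d ≠ (0 : R[X]) := by
    intro h0
    have ha : a = 0 := by simpa [coeff_X_pow] using congrArg (coeff · 4) h0
    have hb : b = 0 := by simpa [coeff_X_pow] using congrArg (coeff · 2) h0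
    exact h.elim (· ha) (· hb)
  refine (finite_setOfPred_isRoot hne).subset fun x hx => ?_
  simpa using hx

variable {p lam c α β : ℝ}

theorem mem_regularPairs_of_ne
    (hprod : c ^ 4 * α ^ 2 * β ^ 2 - lam ^ 4 * (2 * p - 1) ^ 2 ≠ 0)
    (hdisc : (4 * lam ^ 2 * p * (1 - p) - c ^ 2 * (α ^ 2 + β ^ 2)) ^ 2 -
      4 * (c ^ 4 * α ^ 2 * β ^ 2 - lam ^ 4 * (2 * p - 1) ^ 2) ≠ 0) :
    (α, β) ∈ regularPairs p lam c := by
  have hprod' : (coeffA p lam c α β + coeffB p lam c α β) ^ 2 *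
      (coeffA p lam c α β - coeffB p lam c α β) ^ 2 ≠ 0 := by
    rw [sq_coeffA_add_coeffB_mul_sq_coeffA_sub_coeffB]
    exact_mod_cast hprod
  have hdisc' : (4 * (coeffA p lam c α β * coeffB p lam c α β)) ^ 2 ≠ 0 := by
    have hexpand : (4 * (coeffA p lam c α β * coeffB p lam c α β)) ^ 2 =
        (4 * lam ^ 2 * p * (1 - p) - c ^ 2 * (α ^ 2 + β ^ 2) : ℂ) ^ 2 -
          4 * (c ^ 4 * α ^ 2 * β ^ 2 - lam ^ 4 * (2 * p - 1) ^ 2) := by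
      rw [← sq_coeffA_add_coeffB_add_sq_coeffA_sub_coeffB,
        ← sq_coeffA_add_coeffB_mul_sq_coeffA_sub_coeffB]
      ring
    rw [hexpand]
    exact_mod_cast hdisc
  have hAB := right_ne_zero_of_mul (ne_zero_pow two_ne_zero hdisc')
  exact ⟨left_ne_zero_of_mul hAB, right_ne_zero_of_mul hAB,
    ne_zero_pow two_ne_zero (left_ne_zero_of_mul hprod'),
    ne_zero_pow two_ne_zero (right_ne_zero_of_mul hprod')⟩

theorem finite_setOf_notMem_regularPairs (hc : c ≠ 0) (hβ : β ≠ 0) :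
    {α : ℝ | (α, β) ∉ regularPairs p lam c}.Finite := by
  have hprod := finite_setOf_biquadratic_eq_zero (a := 0) (b := c ^ 4 * β ^ 2)
    (-(lam ^ 4 * (2 * p - 1) ^ 2)) (Or.inr (by positivity))
  have hdisc := finite_setOf_biquadratic_eq_zero (a := c ^ 4)
    (b := -2 * c ^ 2 * (4 * lam ^ 2 * p * (1 - p) - c ^ 2 * β ^ 2) - 4 * c ^ 4 * β ^ 2)
    ((4 * lam ^ 2 * p * (1 - p) - c ^ 2 * β ^ 2) ^ 2 + 4 * (lam ^ 4 * (2 * p - 1) ^ 2))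
    (Or.inl (by positivity))
  refine (hprod.union hdisc).subset fun α hα => ?_
  by_contra hn
  rw [Set.mem_union, not_or, Set.mem_ofPred_eq, Set.mem_ofPred_eq] at hn
  refine hα (mem_regularPairs_of_ne (fun h => hn.1 ?_) fun h => hn.2 ?_)
  · linear_combination h
  · linear_combination h

theorem dense_regularPairs (hc : c ≠ 0) : Dense (regularPairs p lam c) := by
  rw [Metric.dense_iff]
  rintro ⟨α, β⟩ r hr
  obtain ⟨β', hβ', hβr⟩ := (dense_compl_singleton (0 : ℝ)).exists_dist_lt β hr
  have hfin := finite_setOf_notMem_regularPairs (p := p) (lam := lam) hc hβ'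
  obtain ⟨α', hα', hαr⟩ := (dense_univ.sdiff_finite hfin).exists_dist_lt α hr
  refine ⟨(α', β'), ?_, not_not.1 hα'.2⟩
  rw [Metric.mem_ball, dist_comm, Prod.dist_eq]
  exact max_lt hαr hβr

end Density

end

theorem mainTheorem8 {Ω : Type*} [MeasurableSpace Ω] (μ : Measure Ω) [IsProbabilityMeasure μ]
    (p q lam c : ℝ) (hp : 0 ≤ p) (hq : 0 ≤ q) (hpq : p + q = 1) (hlam : 0 < lam) (hc : 0 < c)
    (J₀ : Ω → ZMod 4) (turn : ℕ → Ω → ZMod 4) (τ : ℕ → Ω → ℝ)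
    (hmotion : IsPlanarMotionData μ p q lam J₀ turn τ) :
    -- the formula, wherever its denominators do not vanish
    (∀ t : ℝ, 0 ≤ t → ∀ α β : ℝ, (α, β) ∈ regularPairs p lam c →
      motionCharFun μ c J₀ turn τ α β t = explicitCharFun p lam c α β t) ∧
    -- at every pair the characteristic function is the limit of the formula along regular pairs,
    -- which are dense
    Dense (regularPairs p lam c) ∧
    (∀ t : ℝ, 0 ≤ t → ∀ α β : ℝ,
      Tendsto (fun z : ℝ × ℝ => explicitCharFun p lam c z.1 z.2 t)
        (𝓝[regularPairs p lam c] (α, β)) (𝓝 (motionCharFun μ c J₀ turn τ α β t))) := by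
  obtain rfl : q = 1 - p := by linarith
  have hformula : ∀ t : ℝ, 0 ≤ t → ∀ α β : ℝ, (α, β) ∈ regularPairs p lam c →
      motionCharFun μ c J₀ turn τ α β t = explicitCharFun p lam c α β t := by
    intro t ht α β h
    rw [hmotion.motionCharFun_eq hlam (isBackwardSolution_of_mem_regularPairs h) ht,
      ← dirAverage_apply, dirAverage_quarticFlow_eq_explicitCharFun h]
  refine ⟨hformula, dense_regularPairs hc.ne', fun t ht α β => ?_⟩
  have hlim := (hmotion.continuous_motionCharFun hlam c ht).tendsto (α, β)
  refine (hlim.mono_left nhdsWithin_le_nhds).congr' ?_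
  filter_upwards [self_mem_nhdsWithin] with z hz using hformula t ht z.1 z.2 hz
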